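/- Say that a group is virtually $\mathcal P$ if it has a subgroup of finite index with property $\mathcal P$, and that a group $P$ is polycyclic if it has a finite series $1 = P_0 \trianglelefteq P_1 \trianglelefteq \cdots \trianglelefteq P_n = P$ in which every factor $P_{i+1}/P_i$ is cyclic. Let $G$ be a virtually soluble group, and let $A, B \le G$ be finitely generated virtually abelian subgroups of $G$. If there are only finitely many double cosets $AgB = \{agb : a \in A,\ b \in B\}$ with $g \in G$, then $G$ is virtually polycyclic. -/

import Mathlib

/-- A group is virtually soluble if it has a soluble subgroup of finite index. -/
def IsVirtuallySoluble (G : Type*) [Group G] : Prop :=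
  ∃ H : Subgroup G, H.FiniteIndex ∧ Group.IsSolvable H

/-- A group is virtually abelian if it has an abelian subgroup of finite index. -/
def IsVirtuallyAbelian (G : Type*) [Group G] : Prop :=
  ∃ H : Subgroup G, H.FiniteIndex ∧ IsMulCommutative H

/-- A group is polycyclic if it has a finite subnormal series
`1 = H 0 ⊴ H 1 ⊴ ⋯ ⊴ H n = G` all of whose factors `H (i + 1) / H i` are cyclic.
(The values `H i` for `i > n` play no role.) -/
def IsPolycyclic (G : Type*) [Group G] : Prop :=
  ∃ (n : ℕ) (H : ℕ → Subgroup G), H 0 = ⊥ ∧ H n = ⊤ ∧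
    ∀ i < n, H i ≤ H (i + 1) ∧
      ∃ _ : ((H i).subgroupOf (H (i + 1))).Normal,
        IsCyclic (H (i + 1) ⧸ (H i).subgroupOf (H (i + 1)))

/-- A group is virtually polycyclic if it has a polycyclic subgroup of finite index. -/
def IsVirtuallyPolycyclic (G : Type*) [Group G] : Prop :=
  ∃ H : Subgroup G, H.FiniteIndex ∧ IsPolycyclic H

/-! Pass to a soluble subgroup of finite index and to finitely generated abelian subgroups `A`, `B`
of it, and induct on derived length. It remains to show that an abelian normal subgroup `M` is
finitely generated (`fg_of_isMulCommutative`). The pairs `(a, b)` with `aM = bM` form a finitely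
generated abelian group `C`, acting on `M` by `x ↦ a * x * b⁻¹`, an affine action over `ℤ[C]`. Each
double coset meets `M` in at most one orbit, so there are finitely many orbits.

The core is `moduleFinite_int`: such a module is finitely generated over `ℤ`. By Noetherian
induction all proper quotients may be assumed so. In a counterexample the annihilator is prime and
some `j = φ c - 1` lies outside it. With `u = δ c`, the map `x ↦ j • x + u` turns the affine action
into a linear one, which preserves each `m ^ k • N`. For a suitable maximal ideal `m`, the image
contains nonzero elements of every `m ^ k • N`, while by Krull's intersection theorem finitely many
orbits reach only bounded depth. -/

/-! ### Affine actions on modules. -/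

/-- `δ : C → N` is a derivation with respect to the action of `C` on `N` through `φ`, and the affine
action `x ↦ φ c • x + δ c` of `C` on `N` has finitely many orbits. -/
def HasFinitelyManyAffineOrbits {C R N : Type*} [CommGroup C] [CommRing R] [AddCommGroup N]
    [Module R N] (φ : C →* R) (δ : C → N) : Prop :=
  (∀ c d, δ (c * d) = φ c • δ d + δ c) ∧
    ∃ S : Set N, S.Finite ∧ ∀ x, ∃ s ∈ S, ∃ c, x = φ c • s + δ c

namespace HasFinitelyManyAffineOrbits

variable {C R N : Type*} [CommGroup C] [CommRing R] [AddCommGroup N] [Module R N]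
  {φ : C →* R} {δ : C → N}

theorem quotient (h : HasFinitelyManyAffineOrbits φ δ) (K : Submodule R N) :
    HasFinitelyManyAffineOrbits φ (fun c => K.mkQ (δ c)) := by
  obtain ⟨hδ, S, hS, hx⟩ := h
  refine ⟨fun c d => by simp [hδ], K.mkQ '' S, hS.image _, fun x => ?_⟩
  obtain ⟨x, rfl⟩ := K.mkQ_surjective x
  obtain ⟨s, hs, c, rfl⟩ := hx x
  exact ⟨_, ⟨s, hs, rfl⟩, c, by simp⟩

theorem moduleFinite [Group.FG C] (h : HasFinitelyManyAffineOrbits φ δ) : Module.Finite R N := by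
  obtain ⟨hδ, S, hS, hx⟩ := h
  obtain ⟨X, hX, hXfin⟩ := Group.fg_iff.1 (inferInstance : Group.FG C)
  have hone : δ 1 = 0 := by simpa using hδ 1 1
  set W : Submodule R N := Submodule.span R (S ∪ δ '' X) with hW
  have hmem : ∀ c, δ c ∈ W := by
    intro c
    have hc : c ∈ Subgroup.closure X := hX ▸ Subgroup.mem_top c
    induction hc using Subgroup.closure_induction with
    | mem x hx => exact Submodule.subset_span (Or.inr ⟨x, hx, rfl⟩)
    | one => rw [hone]; exact W.zero_mem
    | mul x y _ _ hx hy => rw [hδ]; exact W.add_mem (W.smul_mem _ hy) hx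
    | inv x _ hx =>
      have := hδ x⁻¹ x
      rw [inv_mul_cancel, hone] at this
      rw [eq_neg_of_add_eq_zero_right this.symm]
      exact W.neg_mem (W.smul_mem _ hx)
  refine Module.finite_def.2 (Submodule.fg_def.2 ⟨S ∪ δ '' X, hS.union (hXfin.image _), ?_⟩)
  refine eq_top_iff.2 fun x _ => ?_
  obtain ⟨s, hs, c, rfl⟩ := hx x
  exact W.add_mem (W.smul_mem _ (Submodule.subset_span (Or.inl hs))) (hmem c)

/-- The action is by translations, so the scalars may be replaced by `ℤ` with trivial `φ`. -/
theorem moduleFinite_int_of_trivial [Group.FG C] (h : HasFinitelyManyAffineOrbits φ δ)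
    (htriv : ∀ c (x : N), φ c • x = x) : Module.Finite ℤ N := by
  obtain ⟨hδ, S, hS, hx⟩ := h
  have : HasFinitelyManyAffineOrbits (1 : C →* ℤ) δ :=
    ⟨fun c d => by simp [hδ, htriv], S, hS, fun x => by simpa [htriv] using hx x⟩
  exact this.moduleFinite

end HasFinitelyManyAffineOrbits

/-- If every proper quotient of `N` is finitely generated as an abelian group but `N` is not, then
each scalar acts on `N` either as zero or injectively. -/
theorem smul_eq_zero_or_injective_of_finite_quotients {R N : Type*} [CommRing R] [AddCommGroup N]
    [Module R N] (hN : ¬ Module.Finite ℤ N)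
    (hq : ∀ K : Submodule R N, K ≠ ⊥ → Module.Finite ℤ (N ⧸ K)) (r : R) :
    (∀ x : N, r • x = 0) ∨ ∀ x : N, r • x = 0 → x = 0 := by
  by_contra! hcon
  obtain ⟨⟨x, hx⟩, y, hy, hy0⟩ := hcon
  let f : N →ₗ[R] N := LinearMap.lsmul R N r
  have hker : f.ker ≠ ⊥ := fun h => hy0 (LinearMap.ker_eq_bot'.1 h y hy)
  have hrange : f.range ≠ ⊥ := fun h => hx (LinearMap.congr_fun (LinearMap.range_eq_bot.1 h) x)
  have h1 := hq _ hker
  have h2 := hq _ hrange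
  -- `N` is an extension of `N ⧸ f.range` by `f.range ≃ N ⧸ f.ker`.
  have h3 : Module.Finite ℤ f.range :=
    Module.Finite.equiv (f.quotKerEquivRange.restrictScalars ℤ)
  have : Module.Finite ℤ (f.range.restrictScalars ℤ) := h3
  have : Module.Finite ℤ (N ⧸ f.range.restrictScalars ℤ) := h2
  exact hN (Module.Finite.of_submodule_quotient (f.range.restrictScalars ℤ))

instance Int.instIsJacobsonRing : IsJacobsonRing ℤ := by
  refine isJacobsonRing_iff_prime_eq.2 fun P hP => ?_
  by_cases h : P = ⊥
  · subst h
    refine (Submodule.eq_bot_iff _).2 fun x hx => ?_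
    -- `x * x + 1` is a unit of `ℤ`, hence `±1`.
    have := Int.isUnit_iff.1 (Ideal.mem_jacobson_bot.1 hx x)
    have hx0 : x * x = 0 := by
      have := mul_self_nonneg x
      omega
    simpa using hx0
  · have := hP.isMaximal h
    exact Ideal.jacobson_eq_self_of_isMaximal

/-- A finitely generated module killed by a maximal ideal of a finitely generated ring is
finitely generated as an abelian group. -/
theorem moduleFinite_int_of_maximal_smul_eq_zero {R N : Type*} [CommRing R]
    [Algebra.FiniteType ℤ R] [AddCommGroup N] [Module R N] [Module.Finite R N] (m : Ideal R)
    [hm : m.IsMaximal] (h : ∀ r ∈ m, ∀ x : N, r • x = 0) : Module.Finite ℤ N := by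
  have htors : Module.IsTorsionBySet R N m := fun x r => h r r.2 x
  let _ := htors.module
  let _ := Ideal.Quotient.field m
  have : IsScalarTower R (R ⧸ m) N := htors.isScalarTower
  have : Module.Finite (R ⧸ m) N := Module.Finite.of_restrictScalars_finite R (R ⧸ m) N
  have : Module.Finite ℤ (R ⧸ m) := finite_of_finite_type_of_isJacobsonRing ℤ (R ⧸ m)
  exact Module.Finite.trans (R ⧸ m) N

theorem HasFinitelyManyAffineOrbits.moduleFinite_int_of_finite_quotients {C R N : Type*}
    [CommGroup C] [Group.FG C] [CommRing R] [Algebra.FiniteType ℤ R] [AddCommGroup N] [Module R N]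
    {φ : C →* R} {δ : C → N} (h : HasFinitelyManyAffineOrbits φ δ)
    (hq : ∀ K : Submodule R N, K ≠ ⊥ → Module.Finite ℤ (N ⧸ K)) : Module.Finite ℤ N := by
  by_contra hN
  have hdich := smul_eq_zero_or_injective_of_finite_quotients hN hq
  have hNR : Module.Finite R N := h.moduleFinite
  have hnoeth : IsNoetherianRing R := Algebra.FiniteType.isNoetherianRing ℤ R
  have hjac : IsJacobsonRing R := isJacobsonRing_of_finiteType (A := ℤ)
  have hnt : Nontrivial N := by
    by_contra hs
    rw [not_nontrivial_iff_subsingleton] at hs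
    exact hN inferInstance
  obtain ⟨z, hz⟩ := exists_ne (0 : N)
  have hinj : ∀ r : R, r ∉ Module.annihilator R N → ∀ x : N, r • x = 0 → x = 0 := fun r hr =>
    (hdich r).resolve_left fun h0 => hr (Module.mem_annihilator.2 h0)
  obtain ⟨c, hc⟩ : ∃ c, φ c - 1 ∉ Module.annihilator R N := by
    by_contra! hall
    refine hN (h.moduleFinite_int_of_trivial fun c x => ?_)
    simpa [sub_smul, sub_eq_zero] using Module.mem_annihilator.1 (hall c) x
  obtain ⟨hδ, S, hS, hx⟩ := h
  set j := φ c - 1 with hj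
  set u := δ c with hu
  have hcomm : ∀ d, j • δ d = φ d • u - u := fun d => by
    have h1 := hδ c d
    rw [mul_comm, hδ d c] at h1
    rw [hj, sub_smul, one_smul]
    rw [eq_sub_iff_add_eq, sub_add_eq_add_sub, ← h1, ← hu]
    abel
  have horb : ∀ x, ∃ s ∈ S, ∃ d, j • x + u = φ d • (j • s + u) := fun x => by
    obtain ⟨s, hs, d, rfl⟩ := hx x
    refine ⟨s, hs, d, ?_⟩
    rw [smul_add, hcomm, smul_add, smul_comm j]
    abel
  have hprime : (Module.annihilator R N).IsPrime := by
    refine ⟨fun htop => ?_, fun {a b} hab => ?_⟩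
    · have h1 : (1 : R) ∈ Module.annihilator R N := htop ▸ Submodule.mem_top
      exact hz (by simpa using Module.mem_annihilator.1 h1 z)
    · by_contra! hcon
      refine hz (hinj b hcon.2 z (hinj a hcon.1 _ ?_))
      rw [← mul_smul]
      exact Module.mem_annihilator.1 hab z
  -- In a Jacobson ring the prime annihilator is an intersection of maximal ideals.
  obtain ⟨m, hPm, hmax, hjm⟩ : ∃ m : Ideal R, Module.annihilator R N ≤ m ∧ m.IsMaximal ∧ j ∉ m := by
    by_contra! hcon
    refine hc ?_
    rw [← hjac.out hprime.isRadical]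
    exact Ideal.mem_sInf.2 fun {I} hI => hcon I hI.1 hI.2
  obtain ⟨s, hsm, hsP⟩ : ∃ s ∈ m, s ∉ Module.annihilator R N := by
    by_contra! hcon
    exact hN (moduleFinite_int_of_maximal_smul_eq_zero m
      fun r hr => Module.mem_annihilator.1 (hcon r hr))
  have hdeep : ∀ k : ℕ, ∃ x, j • x + u ≠ 0 ∧ j • x + u ∈ (m ^ k • ⊤ : Submodule R N) := fun k => by
    have hcop : Ideal.span {j} ⊔ m ^ k = ⊤ := by
      rw [← Ideal.isCoprime_iff_sup_eq]
      refine IsCoprime.pow_right ?_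
      rw [Ideal.isCoprime_iff_sup_eq, sup_comm]
      refine hmax.1.2 _ (lt_of_le_of_ne le_sup_left fun he => hjm ?_)
      rw [he]
      exact Ideal.mem_sup_right (Ideal.mem_span_singleton_self j)
    obtain ⟨a, ha, b, hb, hab⟩ := Submodule.mem_sup.1 (hcop ▸ Submodule.mem_top : (1 : R) ∈ _)
    obtain ⟨r, rfl⟩ := Ideal.mem_span_singleton'.1 ha
    -- `j` is invertible modulo `m ^ k`: solve `j • x + u = 0` there, with error `b • u`.
    have hbu : j • (-(r • u)) + u = b • u := by
      rw [← eq_sub_iff_add_eq'] at hab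
      rw [hab, sub_smul 1, one_smul, mul_comm r j, mul_smul, smul_neg]
      abel
    have hbmem : b • u ∈ (m ^ k • ⊤ : Submodule R N) := Submodule.smul_mem_smul hb trivial
    by_cases hb0 : b • u = 0
    · refine ⟨-(r • u) + s ^ k • z, ?_, ?_⟩
      · rw [smul_add, add_right_comm, hbu, hb0, zero_add]
        exact fun h0 => hz (hinj _ (fun hk => hsP (hprime.mem_of_pow_mem _ hk)) _ (hinj j hc _ h0))
      · rw [smul_add, add_right_comm, hbu]
        exact Submodule.add_mem _ hbmem (Submodule.smul_mem _ _
          (Submodule.smul_mem_smul (Ideal.pow_mem_pow hsm k) trivial))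
    · exact ⟨-(r • u), hbu ▸ hb0, hbu ▸ hbmem⟩
  have hkrull : ∀ w : N, w ≠ 0 → ∃ k : ℕ, w ∉ (m ^ k • ⊤ : Submodule R N) := fun w hw => by
    by_contra! hall
    -- Krull gives `r ∈ m` fixing `w`; then `1 - r` annihilates `N`, which forces `1 ∈ m`.
    obtain ⟨r, hr⟩ := (Ideal.mem_iInf_smul_pow_eq_bot_iff m w).1 ((Submodule.mem_iInf _).2 hall)
    refine hmax.ne_top ((Ideal.eq_top_iff_one _).2 ?_)
    have : 1 - (r : R) ∈ Module.annihilator R N := by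
      by_contra hcon
      exact hw (hinj _ hcon w (by rw [sub_smul, one_smul, hr, sub_self]))
    simpa using m.add_mem (hPm this) r.2
  have hk : ∀ t, ∃ k : ℕ, j • t + u ≠ 0 → j • t + u ∉ (m ^ k • ⊤ : Submodule R N) := fun t => by
    by_cases h0 : j • t + u = 0
    · exact ⟨0, fun h => absurd h0 h⟩
    · exact (hkrull _ h0).imp fun _ hk _ => hk
  choose κ hκ using hk
  obtain ⟨K, hK⟩ := (hS.image κ).bddAbove
  obtain ⟨x, hx0, hxK⟩ := hdeep K
  obtain ⟨t, ht, d, hd⟩ := horb x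
  have hinv : φ d⁻¹ • (j • x + u) = j • t + u := by
    rw [hd, ← mul_smul, ← map_mul, inv_mul_cancel, map_one, one_smul]
  refine hκ t (fun h0 => hx0 (by rw [hd, h0, smul_zero])) ?_
  refine Submodule.smul_mono_left (Ideal.pow_le_pow_right (hK ⟨t, ht, rfl⟩)) ?_
  exact hinv ▸ Submodule.smul_mem _ _ hxK

/-- If an affine action of a finitely generated abelian group on a module has finitely many
orbits, then the module is finitely generated as an abelian group. -/
theorem HasFinitelyManyAffineOrbits.moduleFinite_int {C R N : Type*}
    [CommGroup C] [Group.FG C] [CommRing R] [Algebra.FiniteType ℤ R] [AddCommGroup N] [Module R N]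
    {φ : C →* R} {δ : C → N} (h : HasFinitelyManyAffineOrbits φ δ) : Module.Finite ℤ N := by
  have hNR : Module.Finite R N := h.moduleFinite
  have hnoeth : IsNoetherianRing R := Algebra.FiniteType.isNoetherianRing ℤ R
  have hall : ∀ K : Submodule R N, Module.Finite ℤ (N ⧸ K) := by
    intro K
    induction K using IsNoetherian.induction with
    | hgt K ih =>
    refine (h.quotient K).moduleFinite_int_of_finite_quotients fun J hJ => ?_
    have hlt : K < J.comap K.mkQ := by
      refine lt_of_le_of_ne (fun x hx => ?_) fun he => hJ ?_
      · have : K.mkQ x = 0 := by simpa using hx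
        rw [Submodule.mem_comap, this]
        exact J.zero_mem
      · rw [← Submodule.map_comap_eq_of_surjective K.mkQ_surjective J, ← he]
        simp
    have := ih _ hlt
    let f : N →ₗ[R] (N ⧸ K) ⧸ J := J.mkQ ∘ₗ K.mkQ
    have hle : J.comap K.mkQ ≤ f.ker := fun x hx => by
      simpa [f] using hx
    let g := (J.comap K.mkQ).liftQ f hle
    have hg : Function.Surjective g := by
      intro y
      obtain ⟨y, rfl⟩ := J.mkQ_surjective y
      obtain ⟨y, rfl⟩ := K.mkQ_surjective y
      exact ⟨(J.comap K.mkQ).mkQ y, rfl⟩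
    exact Module.Finite.of_surjective (g.restrictScalars ℤ) hg
  have := hall ⊥
  exact Module.Finite.equiv ((Submodule.quotEquivOfEqBot (⊥ : Submodule R N) rfl).restrictScalars ℤ)


/-! ### Translation to groups. -/

/-- Multiplicative form of `HasFinitelyManyAffineOrbits.moduleFinite_int`. -/
theorem Group.fg_of_finite_affine_orbits {C M : Type*} [CommGroup C] [Group.FG C] [CommGroup M]
    (ρ : C →* MulAut M) (δ : C → M) (hδ : ∀ c d, δ (c * d) = ρ c (δ d) * δ c)
    {S : Set M} (hS : S.Finite) (horb : ∀ x, ∃ s ∈ S, ∃ c, x = ρ c s * δ c) : Group.FG M := by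
  let σ : C →* Module.End ℤ (Additive M) :=
    { toFun := fun c => (MonoidHom.toAdditive (ρ c).toMonoidHom).toIntLinearMap
      map_one' := by ext x; simp
      map_mul' := fun c d => by ext x; simp }
  let _ : Module (MonoidAlgebra ℤ C) (Additive M) :=
    Module.compHom (Additive M) (MonoidAlgebra.lift ℤ (Module.End ℤ (Additive M)) C σ).toRingHom
  have hsmul : ∀ c (x : Additive M),
      MonoidAlgebra.of ℤ C c • x = Additive.ofMul (ρ c x.toMul) := fun c x =>
    LinearMap.congr_fun (MonoidAlgebra.lift_of (R := ℤ) σ c) x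
  have h : HasFinitelyManyAffineOrbits (MonoidAlgebra.of ℤ C)
      (fun c => Additive.ofMul (δ c)) := by
    refine ⟨fun c d => ?_, Additive.toMul ⁻¹' S, hS.preimage Additive.toMul.injective.injOn,
      fun x => ?_⟩
    · rw [hsmul]; exact congrArg Additive.ofMul (hδ c d)
    · obtain ⟨s, hs, c, hc⟩ := horb x.toMul
      exact ⟨Additive.ofMul s, hs, c, by rw [hsmul]; exact congrArg Additive.ofMul hc⟩
  have : Monoid.FG C := Group.fg_iff_monoid_fg.1 inferInstance
  have hft : Algebra.FiniteType ℤ (MonoidAlgebra ℤ C) := MonoidAlgebra.finiteType_of_fg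
  have : @Algebra.FiniteType ℤ (MonoidAlgebra ℤ C) _ _ (Ring.toIntAlgebra _) := by
    rw [Subsingleton.elim (Ring.toIntAlgebra (MonoidAlgebra ℤ C)) MonoidAlgebra.algebra]
    exact hft
  exact GroupFG.iff_add_fg.2 (Module.Finite.iff_addGroup_fg.1 h.moduleFinite_int)

theorem Subgroup.group_fg_of_commGroup {G : Type*} [CommGroup G] [Group.FG G] (H : Subgroup G) :
    Group.FG H := by
  have : Module.Finite ℤ (Additive G) :=
    Module.Finite.iff_addGroup_fg.2 (GroupFG.iff_add_fg.1 inferInstance)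
  have hfg := IsNoetherian.noetherian (AddSubgroup.toIntSubmodule H.toAddSubgroup)
  rw [Submodule.fg_iff_addSubgroup_fg] at hfg
  rw [Group.fg_iff_subgroup_fg, Subgroup.fg_iff_add_fg]
  exact hfg

theorem Group.FG.subgroup_map {G G' : Type*} [Group G] [Group G'] {A : Subgroup G}
    (hA : Group.FG A) (f : G →* G') : Group.FG (A.map f) :=
  Group.fg_of_surjective (f.subgroupMap_surjective A)

/-! ### Finitely many double cosets. -/

/-- The group `G` is a union of finitely many double cosets `A t B`. -/
def FinitelyManyDoubleCosets {G : Type*} [Group G] (A B : Subgroup G) : Prop :=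
  ∃ T : Set G, T.Finite ∧ ∀ g, ∃ t ∈ T, ∃ a ∈ A, ∃ b ∈ B, g = a * t * b

theorem FinitelyManyDoubleCosets.of_finite_quotient {G : Type*} [Group G] {A B : Subgroup G}
    (h : Finite (DoubleCoset.Quotient (A : Set G) (B : Set G))) :
    FinitelyManyDoubleCosets A B := by
  refine ⟨Set.range (fun q : DoubleCoset.Quotient (A : Set G) (B : Set G) => q.out),
    Set.finite_range _, fun g => ⟨_, ⟨DoubleCoset.mk A B g, rfl⟩, ?_⟩⟩
  exact (DoubleCoset.eq A B _ g).1 (Quotient.out_eq _)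

theorem Subgroup.exists_finite_representatives {G : Type*} [Group G] {A' A : Subgroup G}
    (h : A'.relIndex A ≠ 0) : ∃ R : Set G, R.Finite ∧ ∀ a ∈ A, ∃ r ∈ R, ∃ a' ∈ A', a = r * a' := by
  have : Finite (A ⧸ A'.subgroupOf A) := Subgroup.index_ne_zero_iff_finite.1 h
  refine ⟨Set.range fun q : A ⧸ A'.subgroupOf A => (q.out : G), Set.finite_range _, fun a ha => ?_⟩
  refine ⟨_, ⟨((⟨a, ha⟩ : A) : A ⧸ A'.subgroupOf A), rfl⟩, _, ?_, (mul_inv_cancel_left _ a).symm⟩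
  have := QuotientGroup.eq.1 (Quotient.out_eq ((⟨a, ha⟩ : A) : A ⧸ A'.subgroupOf A))
  exact Subgroup.mem_subgroupOf.1 this

namespace FinitelyManyDoubleCosets

variable {G : Type*} [Group G] {A B : Subgroup G}

open scoped Pointwise in
theorem of_relIndex_ne_zero (h : FinitelyManyDoubleCosets A B) {A' B' : Subgroup G}
    (hA : A'.relIndex A ≠ 0) (hB : B'.relIndex B ≠ 0) : FinitelyManyDoubleCosets A' B' := by
  obtain ⟨T, hT, hg⟩ := h
  obtain ⟨R, hR, hRA⟩ := Subgroup.exists_finite_representatives hA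
  obtain ⟨S, hS, hSB⟩ := Subgroup.exists_finite_representatives hB
  refine ⟨R⁻¹ * T * S, (hR.inv.mul hT).mul hS, fun g => ?_⟩
  obtain ⟨t, ht, a, ha, b, hb, rfl⟩ := hg g
  obtain ⟨r, hr, a', ha', har⟩ := hRA _ (A.inv_mem ha)
  obtain ⟨s, hs, b', hb', rfl⟩ := hSB b hb
  refine ⟨r⁻¹ * t * s, Set.mul_mem_mul (Set.mul_mem_mul (Set.inv_mem_inv.2 hr) ht) hs,
    a'⁻¹, A'.inv_mem ha', b', hb', ?_⟩
  rw [inv_eq_iff_eq_inv.1 har]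
  group

theorem map {G' : Type*} [Group G'] (h : FinitelyManyDoubleCosets A B) {f : G →* G'}
    (hf : Function.Surjective f) : FinitelyManyDoubleCosets (A.map f) (B.map f) := by
  obtain ⟨T, hT, hg⟩ := h
  refine ⟨f '' T, hT.image f, fun g => ?_⟩
  obtain ⟨g, rfl⟩ := hf g
  obtain ⟨t, ht, a, ha, b, hb, rfl⟩ := hg g
  exact ⟨f t, ⟨t, ht, rfl⟩, f a, Subgroup.mem_map_of_mem f ha, f b, Subgroup.mem_map_of_mem f hb,
    by simp⟩

theorem subgroupOf (h : FinitelyManyDoubleCosets A B) {H : Subgroup G} (hA : A ≤ H) (hB : B ≤ H) :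
    FinitelyManyDoubleCosets (A.subgroupOf H) (B.subgroupOf H) := by
  obtain ⟨T, hT, hg⟩ := h
  refine ⟨(↑) ⁻¹' T, hT.preimage Subtype.val_injective.injOn, fun g => ?_⟩
  obtain ⟨t, ht, a, ha, b, hb, hgt⟩ := hg g
  have htH : t ∈ H := by
    rw [← H.mul_mem_cancel_left (hA ha), ← H.mul_mem_cancel_right (hB hb), ← hgt]
    exact g.2
  exact ⟨⟨t, htH⟩, ht, ⟨a, hA ha⟩, ha, ⟨b, hB hb⟩, hb, Subtype.ext hgt⟩

/-- If `G` is a union of finitely many double cosets of finitely generated abelian subgroups,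
then every abelian normal subgroup of `G` is finitely generated. -/
theorem fg_of_isMulCommutative (h : FinitelyManyDoubleCosets A B) [hAc : IsMulCommutative A]
    [hBc : IsMulCommutative B] (hAfg : Group.FG A) (hBfg : Group.FG B) (M : Subgroup G) [M.Normal]
    [hMc : IsMulCommutative M] : Group.FG M := by
  let _ : CommGroup A := { (inferInstance : Group A) with mul_comm := hAc.1.1 }
  let _ : CommGroup B := { (inferInstance : Group B) with mul_comm := hBc.1.1 }
  let _ : CommGroup M := { (inferInstance : Group M) with mul_comm := hMc.1.1 }
  have hABfg : Group.FG (A × B) := inferInstance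
  let C : Subgroup (A × B) :=
    ((QuotientGroup.mk' M).comp (A.subtype.comp (MonoidHom.fst A B))).eqLocus
      ((QuotientGroup.mk' M).comp (B.subtype.comp (MonoidHom.snd A B)))
  have hCmem : ∀ (a : A) (b : B), (a, b) ∈ C ↔ (a : G) * (b : G)⁻¹ ∈ M := fun a b => by
    rw [← QuotientGroup.eq_one_iff (N := M), QuotientGroup.mk_mul, QuotientGroup.mk_inv, mul_inv_eq_one]
    rfl
  have hCfg : Group.FG C := C.group_fg_of_commGroup
  let ρ : C →* MulAut M :=
    (MulAut.conjNormal (H := M)).comp (A.subtype.comp ((MonoidHom.fst A B).comp C.subtype))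
  let δ : C → M := fun c => ⟨_, (hCmem c.1.1 c.1.2).1 c.2⟩
  obtain ⟨T, hT, hg⟩ := h
  -- A base point of `A t B ∩ M`, or the dummy value `1` if this is empty.
  have hrep : ∀ t, ∃ m : M, (∃ x : M, ∃ a ∈ A, ∃ b ∈ B, (x : G) = a * t * b) →
      ∃ a ∈ A, ∃ b ∈ B, (m : G) = a * t * b := fun t => by
    by_cases hex : ∃ x : M, ∃ a ∈ A, ∃ b ∈ B, (x : G) = a * t * b
    · exact hex.imp fun _ hm _ => hm
    · exact ⟨1, fun hm => absurd hm hex⟩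
  choose μ hμ using hrep
  refine Group.fg_of_finite_affine_orbits ρ δ (fun c d => Subtype.ext ?_) (hT.image μ) fun x => ?_
  · simp [ρ, δ, mul_assoc]
  · obtain ⟨t, ht, a, ha, b, hb, hx⟩ := hg x
    obtain ⟨a', ha', b', hb', hm⟩ := hμ t ⟨x, a, ha, b, hb, hx⟩
    have hxm : (x : G) = (a * a'⁻¹) * μ t * (b⁻¹ * b')⁻¹ := by rw [hx, hm]; group
    have hc : ((⟨a * a'⁻¹, A.mul_mem ha (A.inv_mem ha')⟩ : A),
        (⟨b⁻¹ * b', B.mul_mem (B.inv_mem hb) hb'⟩ : B)) ∈ C := by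
      rw [hCmem]
      have hconj : (a * a'⁻¹) * μ t * (a * a'⁻¹)⁻¹ ∈ M :=
        (inferInstance : M.Normal).conj_mem _ (μ t).2 _
      rw [← M.mul_mem_cancel_left hconj]
      convert x.2 using 1
      rw [hxm]
      simp [mul_assoc]
    refine ⟨_, ⟨t, ht, rfl⟩, ⟨_, hc⟩, Subtype.ext ?_⟩
    rw [hxm]
    simp [ρ, δ, mul_assoc]

end FinitelyManyDoubleCosets


/-! ### Polycyclic series. -/

/-- `K` is normal in `L` with cyclic quotient. -/
def Subgroup.IsCyclicStep {G : Type*} [Group G] (K L : Subgroup G) : Prop :=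
  K ≤ L ∧ ∃ _ : (K.subgroupOf L).Normal, IsCyclic (L ⧸ K.subgroupOf L)

theorem Subgroup.isCyclicStep_iff {G : Type*} [Group G] {K L : Subgroup G} :
    K.IsCyclicStep L ↔ K ≤ L ∧ (∀ k ∈ K, ∀ l ∈ L, l * k * l⁻¹ ∈ K) ∧
      ∃ x ∈ L, ∀ y ∈ L, ∃ n : ℤ, (x ^ n)⁻¹ * y ∈ K := by
  refine and_congr_right fun hKL => ?_
  constructor
  · rintro ⟨hn, ⟨q, hq⟩⟩
    refine ⟨fun k hk l hl => hn.conj_mem ⟨k, hKL hk⟩ hk ⟨l, hl⟩, ?_⟩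
    obtain ⟨x, rfl⟩ := QuotientGroup.mk_surjective q
    refine ⟨x, x.2, fun y hy => ?_⟩
    obtain ⟨n, hn⟩ := Subgroup.mem_zpowers_iff.1 (hq ((⟨y, hy⟩ : L) : L ⧸ K.subgroupOf L))
    rw [← QuotientGroup.mk_zpow] at hn
    exact ⟨n, Subgroup.mem_subgroupOf.1 (QuotientGroup.eq.1 hn)⟩
  · rintro ⟨hn, x, hx, hxy⟩
    refine ⟨⟨fun k hk l => hn k hk l l.2⟩, ?_⟩
    have : (K.subgroupOf L).Normal := ⟨fun k hk l => hn k hk l l.2⟩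
    refine ⟨((⟨x, hx⟩ : L) : L ⧸ K.subgroupOf L), fun q => ?_⟩
    obtain ⟨y, rfl⟩ := QuotientGroup.mk_surjective q
    obtain ⟨n, hn⟩ := hxy y y.2
    refine Subgroup.mem_zpowers_iff.2 ⟨n, ?_⟩
    rw [← QuotientGroup.mk_zpow]
    exact QuotientGroup.eq.2 hn

theorem Subgroup.IsCyclicStep.comap {G G' : Type*} [Group G] [Group G'] {f : G →* G'}
    (hf : Function.Surjective f) {K L : Subgroup G'} (h : K.IsCyclicStep L) :
    (K.comap f).IsCyclicStep (L.comap f) := by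
  rw [Subgroup.isCyclicStep_iff] at h ⊢
  obtain ⟨hKL, hn, x, hx, hxy⟩ := h
  obtain ⟨x, rfl⟩ := hf x
  refine ⟨Subgroup.comap_mono hKL, fun k hk l hl => ?_, x, hx, fun y hy => ?_⟩
  · simpa using hn _ hk _ hl
  · simpa using hxy _ hy

theorem isPolycyclic_iff_reflTransGen {G : Type*} [Group G] :
    IsPolycyclic G ↔ Relation.ReflTransGen Subgroup.IsCyclicStep (⊥ : Subgroup G) ⊤ := by
  constructor
  · rintro ⟨n, H, h0, hn, hH⟩
    have : ∀ i ≤ n, Relation.ReflTransGen Subgroup.IsCyclicStep ⊥ (H i) := by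
      intro i
      induction i with
      | zero => exact fun _ => h0 ▸ .refl
      | succ i ih => exact fun hi => (ih (by omega)).tail (hH i (by omega))
    exact hn ▸ this n le_rfl
  · intro h
    have : ∀ L : Subgroup G, Relation.ReflTransGen Subgroup.IsCyclicStep ⊥ L →
        ∃ (n : ℕ) (H : ℕ → Subgroup G), H 0 = ⊥ ∧ H n = L ∧
          ∀ i < n, (H i).IsCyclicStep (H (i + 1)) := by
      intro L hL
      induction hL with
      | refl => exact ⟨0, fun _ => ⊥, rfl, rfl, by simp⟩
      | @tail K L _ hKL ih =>
        obtain ⟨n, H, h0, hn, hH⟩ := ih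
        refine ⟨n + 1, fun i => if i ≤ n then H i else L, by simp [h0], by simp, fun i hi => ?_⟩
        rcases Nat.lt_succ_iff_lt_or_eq.1 hi with hi | rfl
        · simpa [hi.le, Nat.succ_le_of_lt hi] using hH i hi
        · simpa [hn] using hKL
    exact this ⊤ h

theorem Subgroup.isCyclicStep_closure_insert {G : Type*} [Group G] {M : Subgroup G}
    [hM : IsMulCommutative M] {x : G} {s : Set G} (hx : x ∈ M) (hs : s ⊆ M) :
    (closure s).IsCyclicStep (closure (insert x s)) := by
  have hsM : closure s ≤ M := (closure_le M).2 hs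
  have hxM : closure (insert x s) ≤ M := (closure_le M).2 (Set.insert_subset hx hs)
  rw [isCyclicStep_iff]
  refine ⟨closure_mono (Set.subset_insert _ _), fun k hk l hl => ?_, x,
    subset_closure (Set.mem_insert _ _), fun y hy => ?_⟩
  · rwa [setLike_mul_comm (s := M) (hxM hl) (hsM hk), mul_inv_cancel_right]
  · induction hy using closure_induction with
    | mem y hy =>
      rcases hy with rfl | hy
      · exact ⟨1, by simp⟩
      · exact ⟨0, by simpa using subset_closure hy⟩
    | one => exact ⟨0, by simp⟩
    | mul y z _ hz hy' hz' =>
      obtain ⟨n, hn⟩ := hy'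
      obtain ⟨k, hk⟩ := hz'
      refine ⟨n + k, ?_⟩
      have hcomm := setLike_mul_comm (s := M) (hsM hn) (M.zpow_mem hx (-k))
      have : (x ^ (n + k))⁻¹ * (y * z) = ((x ^ n)⁻¹ * y) * ((x ^ k)⁻¹ * z) := by
        rw [← zpow_neg x k, ← mul_assoc _ (x ^ (-k)) z, hcomm]
        group
      rw [this]
      exact mul_mem hn hk
    | inv y hy hy' =>
      obtain ⟨n, hn⟩ := hy'
      refine ⟨-n, ?_⟩
      rw [zpow_neg, inv_inv, setLike_mul_comm (s := M) (M.zpow_mem hx n)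
        (M.inv_mem (hxM hy))]
      simpa using inv_mem hn

theorem Subgroup.reflTransGen_isCyclicStep_of_fg {G : Type*} [Group G] {M : Subgroup G}
    [IsMulCommutative M] (hM : M.FG) : Relation.ReflTransGen IsCyclicStep ⊥ M := by
  obtain ⟨S, rfl⟩ := hM
  have : ∀ s : Finset G, s ⊆ S → Relation.ReflTransGen IsCyclicStep ⊥ (closure (s : Set G)) := by
    classical
    intro s
    induction s using Finset.induction_on with
    | empty => intro _; simpa using Relation.ReflTransGen.refl
    | insert x s _ ih =>
      intro hs
      rw [Finset.insert_subset_iff] at hs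
      refine (ih hs.2).tail ?_
      rw [Finset.coe_insert]
      exact isCyclicStep_closure_insert (M := closure (S : Set G)) (subset_closure hs.1)
        ((Finset.coe_subset.2 hs.2).trans subset_closure)
  exact this S le_rfl

/-- A series of `M`, adding one generator at a time, is continued by the preimage of a series of `G
⧸ M`. -/
theorem IsPolycyclic.of_quotient {G : Type*} [Group G] (M : Subgroup G) [M.Normal]
    [IsMulCommutative M] (hM : M.FG) (h : IsPolycyclic (G ⧸ M)) : IsPolycyclic G := by
  rw [isPolycyclic_iff_reflTransGen] at h ⊢
  refine (Subgroup.reflTransGen_isCyclicStep_of_fg hM).trans ?_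
  have := Relation.ReflTransGen.lift (p := Subgroup.IsCyclicStep)
    (Subgroup.comap (QuotientGroup.mk' M))
    (fun _ _ hKL => hKL.comap (QuotientGroup.mk'_surjective M)) _ _ h
  simpa [Function.onFun, MonoidHom.comap_bot] using this

/-! ### Induction on derived length and reduction to finite index. -/

/-- A soluble group that is a union of finitely many double cosets of two finitely generated
abelian subgroups is polycyclic. -/
theorem FinitelyManyDoubleCosets.isPolycyclic {G : Type*} [Group G] {A B : Subgroup G}
    (h : FinitelyManyDoubleCosets A B) [IsMulCommutative A] [IsMulCommutative B]
    (hA : Group.FG A) (hB : Group.FG B) {n : ℕ} (hn : derivedSeries G n = ⊥) : IsPolycyclic G := by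
  induction n generalizing G with
  | zero => exact ⟨0, fun _ => ⊥, rfl, hn.symm, by simp⟩
  | succ n ih =>
    have hc : IsMulCommutative (derivedSeries G n) := by
      rw [← Subgroup.le_centralizer_iff_isMulCommutative,
        ← Subgroup.commutator_eq_bot_iff_le_centralizer]
      exact hn
    refine IsPolycyclic.of_quotient (derivedSeries G n)
      ((Group.fg_iff_subgroup_fg _).1 (h.fg_of_isMulCommutative hA hB _)) ?_
    have hsurj := QuotientGroup.mk'_surjective (derivedSeries G n)
    refine ih (h.map hsurj) (hA.subgroup_map _) (hB.subgroup_map _) ?_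
    rw [← map_derivedSeries_eq hsurj, QuotientGroup.map_mk'_self]

theorem Subgroup.group_fg_subgroupOf_iff {G : Type*} [Group G] {K H : Subgroup G} (h : K ≤ H) :
    Group.FG (K.subgroupOf H) ↔ Group.FG K :=
  let e := Subgroup.subgroupOfEquivOfLe h
  ⟨fun _ => Group.fg_of_surjective (f := e.toMonoidHom) e.surjective,
    fun _ => Group.fg_of_surjective (f := e.symm.toMonoidHom) e.symm.surjective⟩

theorem IsVirtuallyAbelian.exists_fg_isMulCommutative_le {G : Type*} [Group G] {A H : Subgroup G}
    (hA : IsVirtuallyAbelian A) (hfg : A.FG) (hH : H.FiniteIndex) :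
    ∃ A' ≤ H, A'.relIndex A ≠ 0 ∧ IsMulCommutative A' ∧ Group.FG A' := by
  obtain ⟨D, hD, hDc⟩ := hA
  have hDA : D.map A.subtype ≤ A := Subgroup.map_subtype_le D
  have hrel : (D.map A.subtype ⊓ H).relIndex A ≠ 0 := by
    refine Subgroup.relIndex_inf_ne_zero ?_ (mt Subgroup.index_eq_zero_of_relIndex_eq_zero hH.index_ne_zero)
    rw [Subgroup.relIndex, Subgroup.subgroupOf, Subgroup.comap_map_eq_self_of_injective
      A.subtype_injective]
    exact hD.index_ne_zero
  refine ⟨D.map A.subtype ⊓ H, inf_le_right, hrel, ?_, ?_⟩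
  · exact .of_setLike_mul_comm fun a ha b hb =>
      setLike_mul_comm (s := D.map A.subtype) ha.1 hb.1
  · have := (Group.fg_iff_subgroup_fg A).2 hfg
    have : ((D.map A.subtype ⊓ H).subgroupOf A).FiniteIndex := ⟨hrel⟩
    exact (Subgroup.group_fg_subgroupOf_iff (inf_le_left.trans hDA)).1 inferInstance

theorem theoremC {G : Type*} [Group G] (hG : IsVirtuallySoluble G)
    (A B : Subgroup G) (hAfg : A.FG) (hBfg : B.FG)
    (hA : IsVirtuallyAbelian A) (hB : IsVirtuallyAbelian B)
    (hfin : Finite (DoubleCoset.Quotient (A : Set G) (B : Set G))) :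
    IsVirtuallyPolycyclic G := by
  obtain ⟨H, hH, n, hn⟩ := hG
  obtain ⟨A', hA'H, hA'A, _, hA'fg⟩ := hA.exists_fg_isMulCommutative_le hAfg hH
  obtain ⟨B', hB'H, hB'B, _, hB'fg⟩ := hB.exists_fg_isMulCommutative_le hBfg hH
  have hdc := ((FinitelyManyDoubleCosets.of_finite_quotient hfin).of_relIndex_ne_zero
    hA'A hB'B).subgroupOf hA'H hB'H
  exact ⟨H, hH, hdc.isPolycyclic
    ((Subgroup.group_fg_subgroupOf_iff hA'H).2 hA'fg)
    ((Subgroup.group_fg_subgroupOf_iff hB'H).2 hB'fg) hn⟩
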